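/- **Definitions.** All graphs are finite and simple. For a graph $G$ and a real $p\ge 1$, let $$\mathcal E_p^+(G)=\sum_{\lambda_i(G)>0}\lambda_i(G)^p ,$$ where $\lambda_1(G),\lambda_2(G),\dots$ are the eigenvalues of the adjacency matrix of $G$, counted with multiplicity, and let $s^+(G)=\sum_{\lambda_i(G)>0}\lambda_i(G)^2=\mathcal E_2^+(G)$. For distinct non-adjacent vertices $u,v$ of $G$, let $G+uv$ be the graph obtained from $G$ by adding the edge $uv$. For $n\ge 1$, let $S_{n,n}$ be the double star obtained from two disjoint stars $K_{1,n-1}$ with centers $v_1$ and $v_2$ by adding the edge $v_1v_2$, and let $\overline{S_{n,n}}$ be its complement. **Theorem.** 1. For each fixed real $p$ with $1\le p<3$ there are connected graphs $G$ of arbitrarily large order, with distinct vertices $u,v$ such that $uv\notin E(G)$, for which $$\mathcal E_p^+(G+uv)<\mathcal E_p^+(G).$$ 2. For every $n\ge 3$ the graph $G=\overline{S_{n,n}}$ is connected, $v_1v_2\notin E(G)$, and $\mathcal E_1^+(G+v_1v_2)<\mathcal E_1^+(G)$. 3. For every real $p$ with $1<p<3$ there is an $n_0$, depending only on $p$, such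 that for all $n\ge n_0$ the graph $G=\overline{S_{n,n}}$ is connected, $v_1v_2\notin E(G)$, and $\mathcal E_p^+(G+v_1v_2)<\mathcal E_p^+(G)$. 4. Consequently, Guo's conjecture, that $s^+(G+uv)\ge s^+(G)$ for every graph $G$ and all distinct vertices $u,v$ with $uv\notin E(G)$, is false. -/

import Mathlib

namespace GraphEnergy

open Classical in
/-- The eigenvalues of the adjacency matrix of `G`, repeated according to multiplicity. -/
noncomputable def eigenvalues {V : Type*} [Fintype V] (G : SimpleGraph V) : V → ℝ :=
  (show (G.adjMatrix ℝ).IsHermitian from G.isSymm_adjMatrix).eigenvalues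

open Classical in
/-- The positive `p`-energy of `G`: the sum of the `p`-th powers of its positive eigenvalues. -/
noncomputable def posEnergy {V : Type*} [Fintype V] (p : ℝ) (G : SimpleGraph V) : ℝ :=
  ∑ i with 0 < eigenvalues G i, eigenvalues G i ^ p

open Classical in
/-- The positive square energy of `G`: the sum of the squares of its positive eigenvalues. -/
noncomputable def posSquareEnergy {V : Type*} [Fintype V] (G : SimpleGraph V) : ℝ :=
  ∑ i with 0 < eigenvalues G i, eigenvalues G i ^ 2

/-- The graph `G + uv`, obtained from `G` by adding the edge `uv`. -/
def addEdge {V : Type*} (G : SimpleGraph V) (u v : V) : SimpleGraph V :=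
  G ⊔ SimpleGraph.edge u v

/-- The double star: the disjoint union of the star on the vertex set `α` with center `v₁` and
the star on the vertex set `β` with center `v₂`, with an edge added between the two centers.
For `α = Fin n₁` and `β = Fin n₂` it is `S_{n₁,n₂}`. -/
def doubleStar {α β : Type*} (v₁ : α) (v₂ : β) : SimpleGraph (α ⊕ β) :=
  addEdge (SimpleGraph.starGraph v₁ ⊕g SimpleGraph.starGraph v₂) (Sum.inl v₁) (Sum.inr v₂)

end GraphEnergy

/-! Put `m = n - 1`. In the complement of the double star the leaves form a clique and each center
sees the leaves of the other star. The vertices fall into four classes on which `A + 1` is constant,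
so apart from `-1` only four eigenvalues matter, and swapping the two stars splits them into two
quadratics. The positive eigenvalues are `m - 1/2 + √(m² + 1/4)` and `-1/2 + √(m + 1/4)` before the
edge is added, and `m ± √(m² - m + 1)` and `-1 + √m` after it. For `p = 1` the terms `±√(m² - m +
1)` cancel and the sums compare directly. For `1 < p < 3` the largest eigenvalue gains at most
`1/m`, which costs `O(m^(p-2))`, and the new small eigenvalue costs at most `1`. The eigenvalue near
`√m` loses at least `1/2`, worth a multiple of `m^((p-1)/2)`. This loss wins because `p - 2 < (p -
1)/2` exactly when `p < 3`. -/

namespace GraphEnergy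

/-! ### Reduction to the quotient matrix -/

open Polynomial in
/-- If the entries of `A + 1`, for `A` the adjacency matrix, depend only on the classes of their
indices, then the positive eigenvalues are those of the weighted quotient matrix, shifted by `1`. -/
theorem posEnergy_eq_sum_of_quotient {V κ : Type*} [Fintype V] [Fintype κ] [DecidableEq κ]
    (p : ℝ) (G : SimpleGraph V) (c : V → κ) (M : Matrix κ κ ℝ)
    (hM : ∀ x y, (x = y ∨ G.Adj x y → M (c x) (c y) = 1) ∧
      (¬ (x = y ∨ G.Adj x y) → M (c x) (c y) = 0))
    (w : κ → ℝ) (hw : ∀ k, ∑ x, (if c x = k then (1 : ℝ) else 0) = w k) (r : κ → ℝ)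
    (hr : (Matrix.of fun k l => w k * M k l).charpoly = ∏ k, (X - C (r k + 1))) :
    posEnergy p G = ∑ k, if 0 < r k then r k ^ p else 0 := by
  classical
  have hA : (G.adjMatrix ℝ).IsHermitian := G.isSymm_adjMatrix
  let U : Matrix V κ ℝ := Matrix.of fun x k => M (c x) k
  let W : Matrix κ V ℝ := Matrix.of fun k y => if c y = k then 1 else 0
  have hUW : G.adjMatrix ℝ = U * W - Matrix.scalar V 1 := by
    ext x y
    have h1 : (U * W) x y = M (c x) (c y) := by simp [U, W, Matrix.mul_apply]
    rw [Matrix.sub_apply, h1, SimpleGraph.adjMatrix_apply]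
    by_cases hxy : x = y
    · subst hxy
      simp [(hM x x).1 (Or.inl rfl)]
    · by_cases ha : G.Adj x y
      · simp [(hM x y).1 (Or.inr ha), ha, hxy]
      · simp [(hM x y).2 (by tauto), ha, hxy]
  have hWU : W * U = Matrix.of fun k l => w k * M k l := by
    ext k l
    simp only [U, W, Matrix.mul_apply, Matrix.of_apply, ← hw, Finset.sum_mul]
    refine Finset.sum_congr rfl fun x _ => ?_
    split_ifs with h
    · rw [h]
    · simp
  -- `U * W` and `W * U` have the same characteristic polynomial up to a power of `X`, which the
  -- shift by `1` turns into a power of `X + 1`. Powers on both sides make it unnecessary to compare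
  -- the two cardinalities.
  have key : (X - C (-1 : ℝ)) ^ Fintype.card κ * (G.adjMatrix ℝ).charpoly =
      (X - C (-1 : ℝ)) ^ Fintype.card V * ∏ k, (X - C (r k)) := by
    have h := congrArg (fun q => q.comp (X + C (1 : ℝ))) (Matrix.charpoly_mul_comm' U W)
    simp only [mul_comp, pow_comp, X_comp, hWU, hr, prod_comp, sub_comp, C_comp] at h
    rw [← Matrix.charpoly_sub_scalar, ← hUW] at h
    simpa using h
  have hmonic : ∀ a : ℝ, (X - C a) ≠ 0 := X_sub_C_ne_zero
  have hroots := congrArg Polynomial.roots key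
  rw [roots_mul (mul_ne_zero (pow_ne_zero _ (hmonic _)) (Matrix.charpoly_monic _).ne_zero),
    roots_mul (mul_ne_zero (pow_ne_zero _ (hmonic _))
      (Finset.prod_ne_zero_iff.2 fun k _ => hmonic _)),
    roots_pow, roots_pow, roots_X_sub_C, hA.roots_charpoly_eq_eigenvalues,
    roots_prod _ _ (Finset.prod_ne_zero_iff.2 fun k _ => hmonic _)] at hroots
  have hsum := congrArg
    (fun s : Multiset ℝ => (s.map fun t => if 0 < t then t ^ p else 0).sum) hroots
  simp only [Multiset.map_add, Multiset.sum_add, Multiset.map_nsmul, Multiset.sum_nsmul,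
    Multiset.map_singleton, Multiset.sum_singleton, roots_X_sub_C, Multiset.bind_singleton,
    Multiset.map_map] at hsum
  -- The surplus roots are all `-1`, so they add nothing to a sum over positive roots.
  simp only [show ¬ (0 : ℝ) < -1 by norm_num, if_false, smul_zero, zero_add] at hsum
  rw [posEnergy, Finset.sum_filter]
  exact hsum

-- `e` is `1` or `0` according to whether the centers are joined. The swap of the two stars commutes
-- with the quotient: `s₁, s₂` belong to its symmetric vectors, `a₁, a₂` to its antisymmetric ones.
open Polynomial in
theorem charpoly_doubleStar_quotient (m e s₁ s₂ a₁ a₂ : ℝ) (hs : s₁ + s₂ = 2 * m - 1 + e)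
    (hs' : s₁ * s₂ = (2 * m - 1) * e - m) (ha : a₁ + a₂ = -1 - e) (ha' : a₁ * a₂ = e - m) :
    (Matrix.of fun k l => (![1, 1, m, m] : Fin 4 → ℝ) k *
      (!![1, e, 0, 1; e, 1, 1, 0; 0, 1, 1, 1; 1, 0, 1, 1] : Matrix (Fin 4) (Fin 4) ℝ) k l).charpoly
      = ∏ k, (X - C ((![s₁, s₂, a₁, a₂] : Fin 4 → ℝ) k + 1)) := by
  refine Polynomial.funext fun t => ?_
  rw [Matrix.eval_charpoly, Polynomial.eval_prod]
  have h1 : (t - (s₁ + 1)) * (t - (s₂ + 1)) =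
      (t - 1) ^ 2 - (2 * m - 1 + e) * (t - 1) + ((2 * m - 1) * e - m) := by
    rw [← hs, ← hs']; ring
  have h2 : (t - (a₁ + 1)) * (t - (a₂ + 1)) =
      (t - 1) ^ 2 - (-1 - e) * (t - 1) + (e - m) := by
    rw [← ha, ← ha']; ring
  have h3 : ∏ k, eval t (X - C ((![s₁, s₂, a₁, a₂] : Fin 4 → ℝ) k + 1)) =
      ((t - (s₁ + 1)) * (t - (s₂ + 1))) * ((t - (a₁ + 1)) * (t - (a₂ + 1))) := by
    simp [Fin.prod_univ_four]; ring
  rw [h3, h1, h2]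
  simp [Matrix.det_succ_row_zero, Fin.sum_univ_succ, Fin.succAbove, Matrix.submatrix_apply]
  ring

/-! ### Spectrum and connectedness of the complement of the double star -/

/-- The classes of the vertices of a double star: the two centers and the two sets of leaves. -/
def doubleStarClass {n : ℕ} (v₁ v₂ : Fin n) : Fin n ⊕ Fin n → Fin 4
  | Sum.inl x => if x = v₁ then 0 else 2
  | Sum.inr y => if y = v₂ then 1 else 3

theorem sum_doubleStarClass {m : ℕ} (v₁ v₂ : Fin (m + 1)) (k : Fin 4) :
    ∑ x, (if doubleStarClass v₁ v₂ x = k then (1 : ℝ) else 0) =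
      (![1, 1, (m : ℝ), (m : ℝ)] : Fin 4 → ℝ) k := by
  have h : ∀ (v : Fin (m + 1)) (i j : Fin 4),
      ∑ x, (if (if x = v then i else j) = k then (1 : ℝ) else 0) =
        (if i = k then 1 else 0) + if j = k then (m : ℝ) else 0 := fun v i j => by
    have h' : ∀ x, (if (if x = v then i else j) = k then (1 : ℝ) else 0) =
        if x = v then (if i = k then 1 else 0) else if j = k then 1 else 0 := fun x => by
      split_ifs <;> rfl
    simp_rw [h']
    rw [Finset.sum_ite, Finset.filter_eq', Finset.filter_ne']
    simp
  rw [Fintype.sum_sum_type]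
  refine (congrArg₂ (· + ·) (h v₁ 0 2) (h v₂ 1 3)).trans ?_
  clear h
  fin_cases k <;> simp

theorem not_compl_doubleStar_adj_centers {n : ℕ} (v₁ v₂ : Fin n) :
    ¬ ((doubleStar v₁ v₂)ᶜ).Adj (Sum.inl v₁) (Sum.inr v₂) := by
  simp [doubleStar, addEdge, SimpleGraph.edge_adj]

theorem posEnergy_compl_doubleStar (p : ℝ) {m : ℕ} (v₁ v₂ : Fin (m + 1)) (s₁ s₂ a₁ a₂ : ℝ)
    (hs : s₁ + s₂ = 2 * m - 1) (hs' : s₁ * s₂ = - m) (ha : a₁ + a₂ = -1) (ha' : a₁ * a₂ = - m) :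
    posEnergy p (doubleStar v₁ v₂)ᶜ =
      (if 0 < s₁ then s₁ ^ p else 0) + (if 0 < s₂ then s₂ ^ p else 0) +
        (if 0 < a₁ then a₁ ^ p else 0) + (if 0 < a₂ then a₂ ^ p else 0) := by
  refine Eq.trans ?_ (Fin.sum_univ_four fun k => if 0 < (![s₁, s₂, a₁, a₂] : Fin 4 → ℝ) k then
    (![s₁, s₂, a₁, a₂] : Fin 4 → ℝ) k ^ p else 0)
  refine posEnergy_eq_sum_of_quotient p _ (doubleStarClass v₁ v₂) _ ?_ _
    (sum_doubleStarClass v₁ v₂) _ (charpoly_doubleStar_quotient m 0 s₁ s₂ a₁ a₂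
      (by linarith) (by linarith) (by linarith) (by linarith))
  rintro (x | x) (y | y)
  · by_cases hx : x = v₁ <;> by_cases hy : y = v₁ <;>
      simp [doubleStar, addEdge, SimpleGraph.edge_adj, doubleStarClass, hx, hy,
        @eq_comm _ v₁ y, em]
  · by_cases hx : x = v₁ <;> by_cases hy : y = v₂ <;>
      simp [doubleStar, addEdge, SimpleGraph.edge_adj, doubleStarClass, hx, hy]
  · by_cases hx : x = v₂ <;> by_cases hy : y = v₁ <;>
      simp [doubleStar, addEdge, SimpleGraph.edge_adj, doubleStarClass, hx, hy]
  · by_cases hx : x = v₂ <;> by_cases hy : y = v₂ <;>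
      simp [doubleStar, addEdge, SimpleGraph.edge_adj, doubleStarClass, hx, hy,
        @eq_comm _ v₂ y, em]

theorem posEnergy_addEdge_compl_doubleStar (p : ℝ) {m : ℕ} (v₁ v₂ : Fin (m + 1))
    (s₁ s₂ a₁ a₂ : ℝ) (hs : s₁ + s₂ = 2 * m) (hs' : s₁ * s₂ = m - 1) (ha : a₁ + a₂ = -2)
    (ha' : a₁ * a₂ = 1 - m) :
    posEnergy p (addEdge (doubleStar v₁ v₂)ᶜ (Sum.inl v₁) (Sum.inr v₂)) =
      (if 0 < s₁ then s₁ ^ p else 0) + (if 0 < s₂ then s₂ ^ p else 0) +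
        (if 0 < a₁ then a₁ ^ p else 0) + (if 0 < a₂ then a₂ ^ p else 0) := by
  refine Eq.trans ?_ (Fin.sum_univ_four fun k => if 0 < (![s₁, s₂, a₁, a₂] : Fin 4 → ℝ) k then
    (![s₁, s₂, a₁, a₂] : Fin 4 → ℝ) k ^ p else 0)
  refine posEnergy_eq_sum_of_quotient p _ (doubleStarClass v₁ v₂) _ ?_ _
    (sum_doubleStarClass v₁ v₂) _ (charpoly_doubleStar_quotient m 1 s₁ s₂ a₁ a₂
      (by linarith) (by linarith) (by linarith) (by linarith))
  rintro (x | x) (y | y)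
  · by_cases hx : x = v₁ <;> by_cases hy : y = v₁ <;>
      simp [doubleStar, addEdge, SimpleGraph.edge_adj, doubleStarClass, hx, hy,
        @eq_comm _ v₁ y, em]
  · by_cases hx : x = v₁ <;> by_cases hy : y = v₂ <;>
      simp [doubleStar, addEdge, SimpleGraph.edge_adj, doubleStarClass, hx, hy]
  · by_cases hx : x = v₂ <;> by_cases hy : y = v₁ <;>
      simp [doubleStar, addEdge, SimpleGraph.edge_adj, doubleStarClass, hx, hy]
  · by_cases hx : x = v₂ <;> by_cases hy : y = v₂ <;>
      simp [doubleStar, addEdge, SimpleGraph.edge_adj, doubleStarClass, hx, hy,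
        @eq_comm _ v₂ y, em]

/-- A leaf of one star is adjacent in the complement to every vertex of the other star, so two
leaves `a`, `b` from different stars link everything. -/
theorem connected_compl_doubleStar {n : ℕ} (hn : 2 ≤ n) (v₁ v₂ : Fin n) :
    ((doubleStar v₁ v₂)ᶜ).Connected := by
  have : Nontrivial (Fin n) := Fin.nontrivial_iff_two_le.2 hn
  obtain ⟨a, ha⟩ := exists_ne v₁
  obtain ⟨b, hb⟩ := exists_ne v₂
  have hab : ((doubleStar v₁ v₂)ᶜ).Adj (Sum.inr b) (Sum.inl a) := by
    simp [doubleStar, addEdge, SimpleGraph.edge_adj, ha, hb]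
  have hr : ∀ x, ((doubleStar v₁ v₂)ᶜ).Reachable x (Sum.inl a) := by
    rintro (x | y)
    · refine SimpleGraph.Reachable.trans (SimpleGraph.Adj.reachable ?_) hab.reachable
      simp [doubleStar, addEdge, SimpleGraph.edge_adj, hb]
    · refine SimpleGraph.Adj.reachable ?_
      simp [doubleStar, addEdge, SimpleGraph.edge_adj, ha]
  have : Nonempty (Fin n ⊕ Fin n) := ⟨Sum.inl a⟩
  exact ⟨fun x y => (hr x).trans (hr y).symm⟩


theorem posEnergy_compl_doubleStar_eq (p : ℝ) {m : ℕ} (hm : 2 ≤ m) (v₁ v₂ : Fin (m + 1)) :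
    posEnergy p (doubleStar v₁ v₂)ᶜ =
      (m - 1 / 2 + √((m : ℝ) ^ 2 + 1 / 4)) ^ p + (-1 / 2 + √((m : ℝ) + 1 / 4)) ^ p := by
  have hm' : (2 : ℝ) ≤ m := by exact_mod_cast hm
  have h1 := Real.sq_sqrt (show (0 : ℝ) ≤ (m : ℝ) ^ 2 + 1 / 4 by positivity)
  have h2 := Real.sq_sqrt (show (0 : ℝ) ≤ (m : ℝ) + 1 / 4 by positivity)
  have h1' : (m : ℝ) < √((m : ℝ) ^ 2 + 1 / 4) := Real.lt_sqrt_of_sq_lt (by linarith)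
  have h2' : (1 / 2 : ℝ) < √((m : ℝ) + 1 / 4) := Real.lt_sqrt_of_sq_lt (by linarith)
  rw [posEnergy_compl_doubleStar p v₁ v₂ (m - 1 / 2 + √((m : ℝ) ^ 2 + 1 / 4))
    (m - 1 / 2 - √((m : ℝ) ^ 2 + 1 / 4)) (-1 / 2 + √((m : ℝ) + 1 / 4))
    (-1 / 2 - √((m : ℝ) + 1 / 4)) (by ring) (by linear_combination -h1) (by ring)
    (by linear_combination -h2)]
  rw [if_pos (by linarith), if_neg (by linarith), if_pos (by linarith), if_neg (by linarith)]
  ring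

theorem posEnergy_addEdge_compl_doubleStar_eq (p : ℝ) {m : ℕ} (hm : 2 ≤ m)
    (v₁ v₂ : Fin (m + 1)) :
    posEnergy p (addEdge (doubleStar v₁ v₂)ᶜ (Sum.inl v₁) (Sum.inr v₂)) =
      (m + √((m : ℝ) ^ 2 - m + 1)) ^ p + (m - √((m : ℝ) ^ 2 - m + 1)) ^ p
        + (-1 + √(m : ℝ)) ^ p := by
  have hm' : (2 : ℝ) ≤ m := by exact_mod_cast hm
  have h1 := Real.sq_sqrt (show (0 : ℝ) ≤ (m : ℝ) ^ 2 - m + 1 by nlinarith)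
  have h2 := Real.sq_sqrt (show (0 : ℝ) ≤ (m : ℝ) by positivity)
  have h0 := Real.sqrt_nonneg ((m : ℝ) ^ 2 - m + 1)
  have h1' : √((m : ℝ) ^ 2 - m + 1) < m := (Real.sqrt_lt' (by linarith)).2 (by linarith)
  have h2' : (1 : ℝ) < √(m : ℝ) := Real.lt_sqrt_of_sq_lt (by linarith)
  rw [posEnergy_addEdge_compl_doubleStar p v₁ v₂ (m + √((m : ℝ) ^ 2 - m + 1))
    (m - √((m : ℝ) ^ 2 - m + 1)) (-1 + √(m : ℝ))
    (-1 - √(m : ℝ)) (by ring) (by linear_combination -h1) (by ring)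
    (by linear_combination -h2)]
  rw [if_pos (by linarith), if_pos (by linarith), if_pos (by linarith), if_neg (by linarith)]
  ring

theorem posEnergy_one_addEdge_compl_doubleStar_lt {n : ℕ} (hn : 3 ≤ n) (v₁ v₂ : Fin n) :
    posEnergy 1 (addEdge (doubleStar v₁ v₂)ᶜ (Sum.inl v₁) (Sum.inr v₂)) <
      posEnergy 1 (doubleStar v₁ v₂)ᶜ := by
  obtain ⟨m, rfl⟩ : ∃ m, n = m + 1 := ⟨n - 1, by omega⟩
  have hm : 2 ≤ m := by omega
  rw [posEnergy_compl_doubleStar_eq 1 hm, posEnergy_addEdge_compl_doubleStar_eq 1 hm]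
  simp only [Real.rpow_one]
  have h1 : (m : ℝ) < √((m : ℝ) ^ 2 + 1 / 4) := Real.lt_sqrt_of_sq_lt (by linarith)
  have h2 : √(m : ℝ) < √((m : ℝ) + 1 / 4) := Real.sqrt_lt_sqrt (by positivity) (by linarith)
  linarith

/-! ### Estimates for `1 < p < 3` -/

/-- The graph of `x ↦ x ^ p` lies above its tangent lines. -/
theorem rpow_add_mul_le_rpow {p x y : ℝ} (hp : 1 ≤ p) (hx : 0 < x) (hy : 0 ≤ y) :
    x ^ p + p * x ^ (p - 1) * (y - x) ≤ y ^ p := by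
  have h := one_add_mul_self_le_rpow_one_add (s := y / x - 1)
    (by have := div_nonneg hy hx.le; linarith) hp
  have h3 : (1 + (y / x - 1)) ^ p = y ^ p / x ^ p := by
    rw [add_sub_cancel, Real.div_rpow hy hx.le]
  have hxp : 0 < x ^ p := Real.rpow_pos_of_pos hx p
  rw [h3, le_div_iff₀ hxp] at h
  have h4 : x ^ (p - 1) = x ^ p / x := Real.rpow_sub_one hx.ne' p
  rw [h4]
  refine le_of_eq_of_le ?_ h
  field_simp

/-- With `Y = x ^ ((p - 1) / 2)`, the gain is at most `12 * x ^ (p - 2) + 1` and the loss at least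
`Y / 8`. The thresholds bound the gain by `12 * Y / 200 + Y / 32 < Y / 8`. -/
theorem rpow_addEdge_lt {p x : ℝ} (hp : 1 < p) (hp3 : p < 3) (hx : 4 ≤ x)
    (h1 : 200 ≤ x ^ ((3 - p) / 2)) (h2 : 32 ≤ x ^ ((p - 1) / 2)) :
    (x + √(x ^ 2 - x + 1)) ^ p + (x - √(x ^ 2 - x + 1)) ^ p + (-1 + √x) ^ p <
      (x - 1 / 2 + √(x ^ 2 + 1 / 4)) ^ p + (-1 / 2 + √(x + 1 / 4)) ^ p := by
  have hx0 : 0 < x := by linarith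
  have hs : 2 ≤ √x := Real.le_sqrt_of_sq_le (by linarith)
  have hs1 : √x ≤ √(x + 1 / 4) := Real.sqrt_le_sqrt (by linarith)
  have hq1 : x ≤ √(x ^ 2 + 1 / 4) := Real.le_sqrt_of_sq_le (by linarith)
  have hq2 : x - 1 / 2 ≤ √(x ^ 2 - x + 1) := Real.le_sqrt_of_sq_le (by nlinarith)
  have hq3 : √(x ^ 2 - x + 1) ≤ x - 1 / 2 + 1 / x := by
    refine Real.sqrt_le_iff.2 ⟨by positivity [show 0 ≤ x - 1 / 2 by linarith], ?_⟩
    have h : x * (1 / x) = 1 := by field_simp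
    have h' : 1 / x ≤ 1 / 4 := one_div_le_one_div_of_le (by norm_num) hx
    nlinarith [sq_nonneg (1 / x)]
  have hq4 : √(x ^ 2 - x + 1) ≤ x := Real.sqrt_le_iff.2 ⟨hx0.le, by linarith⟩
  set q := √(x ^ 2 - x + 1)
  -- the largest eigenvalue
  have hbig : (x + q) ^ p ≤ (x - 1 / 2 + √(x ^ 2 + 1 / 4)) ^ p + 12 * x ^ (p - 2) := by
    have h := rpow_add_mul_le_rpow hp.le (show 0 < x + q by linarith)
      (show 0 ≤ x - 1 / 2 + √(x ^ 2 + 1 / 4) by linarith)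
    have hu : (x + q) ^ (p - 1) ≤ 4 * x ^ (p - 1) := by
      calc (x + q) ^ (p - 1) ≤ (2 * x) ^ (p - 1) :=
            Real.rpow_le_rpow (by linarith) (by linarith) (by linarith)
        _ = 2 ^ (p - 1) * x ^ (p - 1) := Real.mul_rpow (by norm_num) hx0.le
        _ ≤ 2 ^ (2 : ℝ) * x ^ (p - 1) := by
            gcongr
            · norm_num
            · linarith
        _ = 4 * x ^ (p - 1) := by norm_num
    have hd : x + q - (x - 1 / 2 + √(x ^ 2 + 1 / 4)) ≤ 1 / x := by linarith
    have hpq : p * (x + q) ^ (p - 1) ≤ 12 * x ^ (p - 1) := by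
      have : 0 ≤ (x + q) ^ (p - 1) := Real.rpow_nonneg (by linarith) _
      nlinarith
    have hb0 : 0 ≤ p * (x + q) ^ (p - 1) :=
      mul_nonneg (by linarith) (Real.rpow_nonneg (by linarith) _)
    have h5 : p * (x + q) ^ (p - 1) * (x + q - (x - 1 / 2 + √(x ^ 2 + 1 / 4))) ≤
        12 * x ^ (p - 1) * (1 / x) :=
      (mul_le_mul_of_nonneg_left hd hb0).trans
        (mul_le_mul_of_nonneg_right hpq (by positivity))
    have h6 : x ^ (p - 2) = x ^ (p - 1) * (1 / x) := by
      rw [show p - 2 = p - 1 - 1 by ring, Real.rpow_sub_one hx0.ne', mul_one_div]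
    rw [h6]
    linarith
  have hsmall : (x - q) ^ p ≤ 1 :=
    Real.rpow_le_one (by linarith) (by linarith) (by linarith)
  -- the second eigenvalue
  have hmid : (-1 + √x) ^ p + x ^ ((p - 1) / 2) / 8 ≤ (-1 / 2 + √(x + 1 / 4)) ^ p := by
    have h := rpow_add_mul_le_rpow hp.le (show 0 < -1 + √x by linarith)
      (show 0 ≤ -1 / 2 + √(x + 1 / 4) by linarith)
    -- `√x ≥ 2` gives `-1 + √x ≥ √x / 2`, and `2 ^ (p - 1) ≤ 4`.
    have hu : x ^ ((p - 1) / 2) / 4 ≤ (-1 + √x) ^ (p - 1) := by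
      calc x ^ ((p - 1) / 2) / 4 = √x ^ (p - 1) / 2 ^ (2 : ℝ) := by
            rw [Real.sqrt_eq_rpow, ← Real.rpow_mul hx0.le]
            norm_num
            ring_nf
        _ ≤ √x ^ (p - 1) / 2 ^ (p - 1) := by
            gcongr
            · norm_num
            · linarith
        _ = (√x / 2) ^ (p - 1) := (Real.div_rpow (by positivity) (by norm_num) _).symm
        _ ≤ (-1 + √x) ^ (p - 1) :=
            Real.rpow_le_rpow (by positivity) (by linarith) (by linarith)
    have hpos : 0 < x ^ ((p - 1) / 2) := Real.rpow_pos_of_pos hx0 _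
    have h5 : x ^ ((p - 1) / 2) / 4 ≤ p * (-1 + √x) ^ (p - 1) := by nlinarith
    have h6 : x ^ ((p - 1) / 2) / 4 * (1 / 2) ≤
        p * (-1 + √x) ^ (p - 1) * (-1 / 2 + √(x + 1 / 4) - (-1 + √x)) :=
      mul_le_mul h5 (by linarith) (by norm_num) (by linarith)
    linarith
  have hsplit : x ^ ((p - 1) / 2) = x ^ (p - 2) * x ^ ((3 - p) / 2) := by
    rw [← Real.rpow_add hx0]
    ring_nf
  have hpos : 0 < x ^ (p - 2) := Real.rpow_pos_of_pos hx0 _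
  have : x ^ (p - 2) * 200 ≤ x ^ ((p - 1) / 2) := by
    rw [hsplit]
    exact mul_le_mul_of_nonneg_left h1 hpos.le
  linarith

theorem exists_posEnergy_addEdge_compl_doubleStar_lt {p : ℝ} (hp : 1 < p) (hp3 : p < 3) :
    ∃ n₀ : ℕ, 3 ≤ n₀ ∧ ∀ n, n₀ ≤ n → ∀ v₁ v₂ : Fin n,
      posEnergy p (addEdge (doubleStar v₁ v₂)ᶜ (Sum.inl v₁) (Sum.inr v₂)) <
        posEnergy p (doubleStar v₁ v₂)ᶜ := by
  have h1 := ((tendsto_rpow_atTop (show 0 < (3 - p) / 2 by linarith)).comp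
    tendsto_natCast_atTop_atTop).eventually_ge_atTop 200
  have h2 := ((tendsto_rpow_atTop (show 0 < (p - 1) / 2 by linarith)).comp
    tendsto_natCast_atTop_atTop).eventually_ge_atTop 32
  obtain ⟨m₀, hm₀⟩ := Filter.eventually_atTop.1
    ((h1.and h2).and (Filter.eventually_ge_atTop 4))
  refine ⟨m₀ + 3, by omega, fun n hn v₁ v₂ => ?_⟩
  obtain ⟨m, rfl⟩ : ∃ m, n = m + 1 := ⟨n - 1, by omega⟩
  obtain ⟨⟨h1, h2⟩, hm⟩ := hm₀ m (by omega)
  rw [posEnergy_compl_doubleStar_eq p (by omega), posEnergy_addEdge_compl_doubleStar_eq p (by omega)]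
  exact rpow_addEdge_lt hp hp3 (by exact_mod_cast hm) h1 h2

theorem posSquareEnergy_eq_posEnergy_two {V : Type*} [Fintype V] (G : SimpleGraph V) :
    posSquareEnergy G = posEnergy 2 G := by
  simp [posSquareEnergy, posEnergy]

end GraphEnergy

theorem theorem3p4 :
    -- for every `p ∈ [1,3)`, connected graphs of arbitrarily large order
    (∀ p : ℝ, 1 ≤ p → p < 3 → ∀ N : ℕ,
      ∃ (V : Type) (_ : Fintype V) (G : SimpleGraph V) (u v : V),
        N ≤ Fintype.card V ∧ G.Connected ∧ u ≠ v ∧ ¬ G.Adj u v ∧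
          GraphEnergy.posEnergy p (GraphEnergy.addEdge G u v) < GraphEnergy.posEnergy p G) ∧
    -- `p = 1`: the complement of `S_{n,n}`, for all `n ≥ 3`
    (∀ n : ℕ, 3 ≤ n → ∀ v₁ v₂ : Fin n,
      ((GraphEnergy.doubleStar v₁ v₂)ᶜ).Connected ∧
      ¬ ((GraphEnergy.doubleStar v₁ v₂)ᶜ).Adj (Sum.inl v₁) (Sum.inr v₂) ∧
      GraphEnergy.posEnergy 1
          (GraphEnergy.addEdge (GraphEnergy.doubleStar v₁ v₂)ᶜ (Sum.inl v₁) (Sum.inr v₂)) <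
        GraphEnergy.posEnergy 1 (GraphEnergy.doubleStar v₁ v₂)ᶜ) ∧
    -- `1 < p < 3`: the complement of `S_{n,n}`, for all sufficiently large `n`
    (∀ p : ℝ, 1 < p → p < 3 → ∃ n₀ : ℕ, ∀ n : ℕ, n₀ ≤ n → ∀ v₁ v₂ : Fin n,
      ((GraphEnergy.doubleStar v₁ v₂)ᶜ).Connected ∧
      ¬ ((GraphEnergy.doubleStar v₁ v₂)ᶜ).Adj (Sum.inl v₁) (Sum.inr v₂) ∧
      GraphEnergy.posEnergy p
          (GraphEnergy.addEdge (GraphEnergy.doubleStar v₁ v₂)ᶜ (Sum.inl v₁) (Sum.inr v₂)) <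
        GraphEnergy.posEnergy p (GraphEnergy.doubleStar v₁ v₂)ᶜ) ∧
    -- the positive square energy is not monotone under edge addition
    ¬ (∀ (V : Type) [Fintype V] (G : SimpleGraph V) (u v : V), u ≠ v → ¬ G.Adj u v →
        GraphEnergy.posSquareEnergy G ≤
          GraphEnergy.posSquareEnergy (GraphEnergy.addEdge G u v)) := by 
  refine ⟨fun p hp hp3 N => ?_, fun n hn v₁ v₂ =>
    ⟨GraphEnergy.connected_compl_doubleStar (by omega) v₁ v₂,
      GraphEnergy.not_compl_doubleStar_adj_centers v₁ v₂,
      GraphEnergy.posEnergy_one_addEdge_compl_doubleStar_lt hn v₁ v₂⟩, fun p hp hp3 => ?_, ?_⟩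
  · obtain ⟨n₀, h3, h⟩ : ∃ n₀ : ℕ, 3 ≤ n₀ ∧ ∀ n : ℕ, n₀ ≤ n → ∀ v₁ v₂ : Fin n,
        GraphEnergy.posEnergy p (GraphEnergy.addEdge (GraphEnergy.doubleStar v₁ v₂)ᶜ
          (Sum.inl v₁) (Sum.inr v₂)) <
          GraphEnergy.posEnergy p (GraphEnergy.doubleStar v₁ v₂)ᶜ := by
      rcases hp.eq_or_lt with rfl | hp
      · exact ⟨3, le_rfl, fun n hn => GraphEnergy.posEnergy_one_addEdge_compl_doubleStar_lt hn⟩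
      · exact GraphEnergy.exists_posEnergy_addEdge_compl_doubleStar_lt hp hp3
    -- The size `n₀ + N` meets both the threshold and the required order.
    let v : Fin (n₀ + N) := ⟨0, by omega⟩
    refine ⟨Fin (n₀ + N) ⊕ Fin (n₀ + N), inferInstance, (GraphEnergy.doubleStar v v)ᶜ,
      Sum.inl v, Sum.inr v, ?_, GraphEnergy.connected_compl_doubleStar (by omega) v v, by simp,
      GraphEnergy.not_compl_doubleStar_adj_centers v v, h _ (by omega) v v⟩
    simp
    omega
  · obtain ⟨n₀, h3, h⟩ := GraphEnergy.exists_posEnergy_addEdge_compl_doubleStar_lt hp hp3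
    exact ⟨n₀, fun n hn v₁ v₂ => ⟨GraphEnergy.connected_compl_doubleStar (by omega) v₁ v₂,
      GraphEnergy.not_compl_doubleStar_adj_centers v₁ v₂, h n hn v₁ v₂⟩⟩
  · intro hguo
    obtain ⟨n₀, h3, h⟩ := GraphEnergy.exists_posEnergy_addEdge_compl_doubleStar_lt
      (show (1 : ℝ) < 2 by norm_num) (by norm_num)
    let v : Fin n₀ := ⟨0, by omega⟩
    have h' := hguo _ (GraphEnergy.doubleStar v v)ᶜ (Sum.inl v) (Sum.inr v) (by simp)
      (GraphEnergy.not_compl_doubleStar_adj_centers v v)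
    rw [GraphEnergy.posSquareEnergy_eq_posEnergy_two,
      GraphEnergy.posSquareEnergy_eq_posEnergy_two] at h'
    exact absurd (h n₀ le_rfl v v) (not_lt.2 h')
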